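/- **Theorem (Stretched algorithm gap size ratio upper bound).** Let $S = 2^{\hat s}$ with $\hat s \ge 2$ an integer. Data items with ingest times $0, 1, 2, \ldots$ arrive one at a time and may each be written to one of the buffer sites $0, \ldots, S-1$, replacing the item stored there. Let $H(T)$ be the largest $n$ such that $2^n$ divides $T+1$. The epoch of time $T$ is $t = \lfloor \log_2 T\rfloor - \hat s + 1$ if $T \ge S$ and $t = 0$ otherwise. The meta-epoch $\tau$ of epoch $t$ is $0$ if $t = 0$, and otherwise it is the largest $\tau$ with $2^\tau - \tau \le t$. The stretched algorithm selects the site of item $T$ as follows. Divide the buffer from left to right into $S/2$ segments of sizes $\hat s+1,\ H(0)+1,\ H(1)+1,\ \ldots,\ H(S/2-2)+1$. Order the segments by descending size, and segments of the same size from left to right. Let $h = H(T)$, and let $i = \lfloor T/2^{h+1}\rfloor$ be the number of earlier items with hanoi value $h$. Let $B = \max(1, \lfloor S/2^{\tau+1}\rfloor)$, with $\tau$ the meta-epoch at time $T$. If $i \ge B$, item $T$ is discarded without being stored; otherwise it is stored at the site that lies $h$ sites to the right of the first site of the $i$-th segment in this order, counted from $0$ (this site may lie beyond the end of that segment, in sites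 initially belonging to segments further right). At time $T$ the items $0, \ldots, T-1$ have been ingested; those that are no longer in the buffer, or never were, are discarded. For $\breve T \in \{0,\ldots,T-1\}$ let the gap size $G_T(\breve T)$ be $0$ if $\breve T$ is in the buffer at time $T$, and otherwise the length of the longest run of consecutive discarded ingest times containing $\breve T$. Then for every $T < 2^{S-1}$, with $t$ the epoch and $\tau$ the meta-epoch at time $T$, $$\max_{1 \le \breve T < T} \frac{G_T(\breve T)}{\breve T} \;\le\; \min\left(\frac{2^{\tau+1}}{S},\ \frac{2(t+\hat s)}{S},\ \frac{4t}{S}\right),$$ where the maximum is read as $0$ if there is no such $\breve T$. -/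

import Mathlib

namespace DStream

/-- The hanoi value `H(T)`: the largest `n` such that `2 ^ n` divides `T + 1`. -/
def hanoi (T : ℕ) : ℕ := padicValNat 2 (T + 1)

/-- The epoch `t` of time `T`, for a buffer of size `2 ^ s`. -/
def epoch (s T : ℕ) : ℕ := if 2 ^ s ≤ T then Nat.log 2 T - s + 1 else 0

/-- The meta-epoch `τ` of epoch `t`: meta-epoch `0` consists of epoch `0` alone, and meta-epoch
`τ ≥ 1` begins at epoch `2 ^ τ - τ` (so that it lasts `2 ^ τ - 1` epochs). Hence for `t ≥ 1` the
meta-epoch is the largest `τ` with `2 ^ τ - τ ≤ t`; such a `τ` is at most `t`. -/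
def metaEpoch (t : ℕ) : ℕ := Nat.findGreatest (fun τ => 2 ^ τ ≤ t + τ) t

/-- Initial sizes of the reservation segments, from left to right in the buffer:
`s + 1, H(0) + 1, H(1) + 1, …, H(2 ^ (s - 1) - 2) + 1`. -/
def segSize (s : ℕ) : ℕ → ℕ
  | 0 => s + 1
  | m + 1 => hanoi m + 1

/-- The leftmost buffer site of the `m`-th segment from the left. -/
def segStart (s m : ℕ) : ℕ := ∑ j ∈ Finset.range m, segSize s j

/-- The left-to-right index of the segment that is `i`-th (from zero) in fill order, i.e. in
descending order of initial size and from left to right among segments of equal initial size.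
Segment `0` comes first; for `i ≥ 1` with bit length `v = Nat.size i`, the nestedness level `v`
consists of the `2 ^ (v - 1)` segments of initial size `s - v`, which start at index
`2 ^ (s - 1 - v)` and are spaced `2 ^ (s - v)` apart, and `i - 2 ^ (v - 1)` is the position
within that level. -/
def fillOrder (s i : ℕ) : ℕ :=
  if i = 0 then 0
  else 2 ^ (s - 1 - Nat.size i) + 2 ^ (s - Nat.size i) * (i - 2 ^ (Nat.size i - 1))

/-- Site selection `K(T)` of the stretched algorithm on a buffer of `2 ^ s` sites, with `none`
meaning that data item `T` is discarded without being stored. If `h = H(T)`, then `T` is the `i`-th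
(from zero) item of hanoi value `h`, where `i = ⌊T / 2 ^ (h + 1)⌋`. During meta-epoch `τ` there are
`B = max 1 ⌊2 ^ s / 2 ^ (τ + 1)⌋` segments available to a hanoi value. If `i ≥ B` the item is
discarded; otherwise it is stored at offset `h` from the start of the `i`-th segment in fill order.
For large `h` this site lies beyond the initial extent of that segment: the segment then invades
the segment to its right. -/
def siteSelect (s T : ℕ) : Option ℕ :=
  let h := hanoi T
  let i := T / 2 ^ (h + 1)
  let B := max 1 (2 ^ s / 2 ^ (metaEpoch (epoch s T) + 1))
  if B ≤ i then none else some (segStart s (fillOrder s i) + h)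

/-- The ingest times of the data items held in the buffer at time `T`, i.e. after the items
`0, …, T - 1` have been ingested: site `k` of the buffer `{0, …, 2 ^ s - 1}` holds the latest item
for which site `k` was selected, if any. -/
def retained (s T : ℕ) : Set ℕ :=
  {x | ∃ k < 2 ^ s, IsGreatest {y | y < T ∧ siteSelect s y = some k} x}

/-- The ingest times of the data items not held in the buffer at time `T`. -/
def discarded (s T : ℕ) : Set ℕ := Set.Iio T \ retained s T

open Classical in
/-- Gap size `G_T(x)` around ingest time `x`: zero if `x` is retained, and otherwise the largest
`i + j` such that all of `x - i, …, x + j - 1` are discarded (negative times are never discarded,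
so `i ≤ x`). -/
noncomputable def gapSize (s T x : ℕ) : ℕ :=
  if x ∈ retained s T then 0
  else sSup {n | ∃ i j : ℕ, n = i + j ∧ i ≤ x ∧ Set.Ico (x - i) (x + j) ⊆ discarded s T}

/-- The stretched cost at time `T`: the maximum of `G_T(x) / x` over ingest times `1 ≤ x < T`
(zero if there is no such `x`). -/
noncomputable def costStretched (s T : ℕ) : ℝ :=
  sSup ((fun x : ℕ => (gapSize s T x : ℝ) / (x : ℝ)) '' Set.Ico 1 T)

end DStream

namespace DStream

/-! Let `r` be the meta-epoch at time `T` and `B = 2 ^ (s - 1 - r)`. The first `B` segments in fill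
order are those whose left-to-right index is a multiple of `2 ^ r`, so they head `B` disjoint blocks
of `2 ^ r` segments. The end of the meta-epoch is timed so that no item outgrows its block
(`site_mem_block`). Hence every item of rank below `B` in its hanoi value is never overwritten
(`mem_retained`). If `2 ^ h * B ≤ x < 2 ^ (h + 1) * B`, all items of hanoi value at least `h` around
`x` are therefore kept. They are at most `2 ^ h` apart, so the gap ratio is at most `1 / B = 2 ^ (r
+ 1) / 2 ^ s`. The other two bounds follow from `2 ^ r ≤ t + r` with `r < s` and `r ≤ t`; in epoch
`0` nothing is lost. -/

lemma pow_hanoi_dvd (T : ℕ) : 2 ^ hanoi T ∣ T + 1 := pow_padicValNat_dvd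

lemma le_hanoi_of_dvd {h T : ℕ} (hd : 2 ^ h ∣ T + 1) : h ≤ hanoi T :=
  (padicValNat_dvd_iff_le (by omega)).1 hd

/-- An ingest time is determined by its hanoi value and its rank among the items of that value. -/
lemma hanoi_decomp (T : ℕ) :
    T + 1 = T / 2 ^ (hanoi T + 1) * 2 ^ (hanoi T + 1) + 2 ^ hanoi T := by
  obtain ⟨c, hc⟩ := pow_hanoi_dvd T
  have hodd : ¬ 2 ∣ c := by
    rintro ⟨d, rfl⟩
    have : hanoi T + 1 ≤ hanoi T := le_hanoi_of_dvd ⟨d, by rw [hc]; ring⟩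
    omega
  obtain ⟨d, rfl⟩ : ∃ d, c = 2 * d + 1 := ⟨c / 2, by omega⟩
  have hpos : 0 < 2 ^ hanoi T := by positivity
  have hT : T = 2 ^ (hanoi T + 1) * d + (2 ^ hanoi T - 1) := by
    have : 2 ^ hanoi T * (2 * d + 1) = 2 ^ (hanoi T + 1) * d + 2 ^ hanoi T := by ring
    omega
  have hdiv : T / 2 ^ (hanoi T + 1) = d := by
    have h1 : 2 ^ (hanoi T + 1) = 2 * 2 ^ hanoi T := by ring
    refine Nat.div_eq_of_lt_le ?_ ?_
    · rw [mul_comm]; omega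
    · rw [mul_comm, mul_add]; omega
  rw [hdiv, hc]
  ring

/-! ### Epochs and meta-epochs. -/

lemma lt_two_pow_epoch (s T : ℕ) : T + 1 ≤ 2 ^ (epoch s T + s) := by
  unfold epoch
  split_ifs with h
  · have h1 : s ≤ Nat.log 2 T := (Nat.le_log_iff_pow_le (by norm_num) (by
      have : 0 < 2 ^ s := by positivity
      omega)).2 h
    rw [show Nat.log 2 T - s + 1 + s = Nat.log 2 T + 1 by omega]
    exact Nat.lt_pow_succ_log_self (by norm_num) T
  · rw [zero_add]; omega

lemma epoch_mono (s : ℕ) : Monotone (epoch s) := by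
  intro a b hab
  have := Nat.log_mono_right (b := 2) hab
  unfold epoch
  split_ifs <;> omega

lemma metaEpoch_mono : Monotone metaEpoch := by
  intro a b hab
  exact Nat.findGreatest_mono (fun n (hn : 2 ^ n ≤ a + n) => by omega) hab

lemma metaEpoch_le (t : ℕ) : metaEpoch t ≤ t := Nat.findGreatest_le t

lemma two_pow_metaEpoch_le {t : ℕ} (ht : 1 ≤ t) : 2 ^ metaEpoch t ≤ t + metaEpoch t :=
  Nat.findGreatest_spec (P := fun τ => 2 ^ τ ≤ t + τ) (m := 0) (Nat.zero_le t) (by simpa using ht)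

lemma two_mul_add_one_lt_two_pow (t : ℕ) : t + (t + 1) < 2 ^ (t + 1) := by
  induction t with
  | zero => norm_num
  | succ n ih => rw [pow_succ]; omega

/-- An epoch ends before its meta-epoch, or any later one, is over. -/
lemma add_lt_two_pow_of_metaEpoch_le {t r : ℕ} (hr : metaEpoch t ≤ r) :
    t + (r + 1) < 2 ^ (r + 1) := by
  by_cases h : r + 1 ≤ t
  · have := Nat.findGreatest_is_greatest (P := fun τ => 2 ^ τ ≤ t + τ) (n := t) (k := r + 1)
      (by change metaEpoch t < r + 1; omega) h
    exact not_le.1 this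
  -- Beyond the search bound of `findGreatest`: here `t ≤ r`, and the inequality holds by growth
  -- alone.
  · have := two_mul_add_one_lt_two_pow r
    omega

/-- Monotonicity of `2 ^ n - n`, free of truncated subtraction. -/
lemma two_pow_sub_mono {a b : ℕ} (hab : a ≤ b) : 2 ^ a + b ≤ 2 ^ b + a := by
  induction b, hab using Nat.le_induction with
  | base => rfl
  | succ n _ ih =>
    have : 0 < 2 ^ n := by positivity
    rw [pow_succ]; omega

lemma metaEpoch_lt {s T : ℕ} (hs : 2 ≤ s) (hT : T < 2 ^ (2 ^ s - 1)) :
    metaEpoch (epoch s T) < s := by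
  by_contra! h
  have hle := metaEpoch_le (epoch s T)
  have h1 := two_pow_metaEpoch_le (t := epoch s T) (by omega)
  have h2 := two_pow_sub_mono h
  have h3 : epoch s T + s < 2 ^ s := by
    have hpos : 0 < 2 ^ s := by positivity
    have hS : s < 2 ^ s := Nat.lt_two_pow_self
    unfold epoch
    split_ifs with hT'
    · have hlog : Nat.log 2 T < 2 ^ s - 1 := Nat.log_lt_of_lt_pow (by omega) hT
      have hslog : s ≤ Nat.log 2 T := (Nat.le_log_iff_pow_le (by norm_num) (by omega)).2 hT'
      omega
    · omega
  omega

/-! ### Segment positions and fill order. -/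

lemma segSize_eq {s m : ℕ} (hm : 1 ≤ m) : segSize s m = padicValNat 2 m + 1 := by
  obtain ⟨m, rfl⟩ := Nat.exists_eq_add_of_le' hm
  rfl

lemma segSize_pos (s m : ℕ) : 0 < segSize s m := by cases m <;> simp [segSize]

lemma segStart_succ (s m : ℕ) : segStart s (m + 1) = segStart s m + segSize s m :=
  Finset.sum_range_succ _ _

lemma segStart_strictMono (s : ℕ) : StrictMono (segStart s) :=
  strictMono_nat_of_lt_succ fun m => by
    have := segSize_pos s m
    rw [segStart_succ]; omega

lemma segStart_one (s : ℕ) : segStart s 1 = s + 1 := by simp [segStart, segSize]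

/-- Doubling a positive index enlarges its segment by one, and each odd index adds a segment of size
one. -/
lemma segStart_two_mul (s : ℕ) {m : ℕ} (hm : 1 ≤ m) :
    segStart s (2 * m) + 1 = segStart s m + 2 * m := by
  induction m, hm using Nat.le_induction with
  | base => simp [segStart, segSize, hanoi, Finset.sum_range_succ]
  | succ m hm ih =>
    have h1 : segSize s (2 * m) = segSize s m + 1 := by
      rw [segSize_eq (by omega), segSize_eq hm, padicValNat.mul (by norm_num) (by omega),
        padicValNat.self (by norm_num)]
      omega
    have h2 : segSize s (2 * m + 1) = 1 := by
      rw [segSize_eq (by omega), padicValNat.eq_zero_of_not_dvd (by omega)]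
    rw [show 2 * (m + 1) = 2 * m + 1 + 1 by ring, segStart_succ, segStart_succ, segStart_succ,
      h1, h2]
    omega

lemma segStart_two_pow_mul (s k : ℕ) {q : ℕ} (hq : 1 ≤ q) :
    segStart s (2 ^ k * q) + k + 2 * q = segStart s q + 2 ^ (k + 1) * q := by
  induction k with
  | zero => simp
  | succ k ih =>
    have h := segStart_two_mul s (m := 2 ^ k * q) (Nat.mul_pos (by positivity) hq)
    rw [show 2 ^ (k + 1) * q = 2 * (2 ^ k * q) by ring] at *
    rw [show 2 ^ (k + 1 + 1) * q = 2 * (2 ^ k * q) + 2 * (2 ^ k * q) by ring]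
    omega

lemma segStart_two_pow (s k : ℕ) : segStart s (2 ^ k) + k + 1 = s + 2 ^ (k + 1) := by
  have := segStart_two_pow_mul s k (q := 1) le_rfl
  rw [segStart_one, mul_one, mul_one] at this
  omega

/-- Total size of a block of `2 ^ k` segments that starts at a positive multiple of `2 ^ k`. -/
lemma segStart_two_pow_mul_succ (s k : ℕ) {q : ℕ} (hq : 1 ≤ q) :
    segStart s (2 ^ k * (q + 1)) + 1
      = segStart s (2 ^ k * q) + padicValNat 2 q + 2 ^ (k + 1) := by
  have h1 := segStart_two_pow_mul s k hq
  have h2 := segStart_two_pow_mul s k (q := q + 1) (by omega)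
  rw [segStart_succ, segSize_eq hq] at h2
  rw [show 2 ^ (k + 1) * (q + 1) = 2 ^ (k + 1) * q + 2 ^ (k + 1) by ring] at h2
  omega

lemma segStart_half {s : ℕ} (hs : 1 ≤ s) : segStart s (2 ^ (s - 1)) = 2 ^ s := by
  have := segStart_two_pow s (s - 1)
  rw [show s - 1 + 1 = s by omega] at this
  omega

lemma padicValNat_two_pow_mul_odd (a j : ℕ) : padicValNat 2 (2 ^ a * (2 * j + 1)) = a := by
  rw [padicValNat.mul (by positivity) (by omega), padicValNat.prime_pow,
    padicValNat.eq_zero_of_not_dvd (by omega : ¬ 2 ∣ 2 * j + 1), add_zero]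

lemma two_pow_size_sub_one_le {i : ℕ} (hi : i ≠ 0) : 2 ^ (Nat.size i - 1) ≤ i :=
  Nat.lt_size.1 (by have := Nat.size_pos.2 (Nat.pos_of_ne_zero hi); omega)

lemma fillOrder_eq {s i : ℕ} (hi : i ≠ 0) (his : i < 2 ^ (s - 1)) :
    fillOrder s i = 2 ^ (s - 1 - Nat.size i) * (2 * (i - 2 ^ (Nat.size i - 1)) + 1) := by
  have h1 := Nat.size_pos.2 (Nat.pos_of_ne_zero hi)
  have h2 := Nat.size_le.2 his
  rw [fillOrder, if_neg hi, show s - Nat.size i = s - 1 - Nat.size i + 1 by omega]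
  ring

/-- The 2-adic valuation of a nonzero segment index recovers the bit length of its rank, and the odd
part recovers the position in that level. -/
lemma fillOrder_injOn (s : ℕ) : Set.InjOn (fillOrder s) (Set.Iio (2 ^ (s - 1))) := by
  intro i hi j hj hij
  have pos : ∀ k, k ≠ 0 → k < 2 ^ (s - 1) → fillOrder s k ≠ 0 := fun k hk hks => by
    rw [fillOrder_eq hk hks]; positivity
  have zero : fillOrder s 0 = 0 := by simp [fillOrder]
  by_cases hi0 : i = 0
  · by_contra hne
    exact pos j (by omega) hj (by rw [← hij, hi0, zero])
  by_cases hj0 : j = 0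
  · exact absurd (by rw [hij, hj0, zero]) (pos i hi0 hi)
  rw [fillOrder_eq hi0 hi, fillOrder_eq hj0 hj] at hij
  have hv := congrArg (padicValNat 2) hij
  rw [padicValNat_two_pow_mul_odd, padicValNat_two_pow_mul_odd] at hv
  have hi2 := Nat.size_le.2 hi
  have hj2 := Nat.size_le.2 hj
  have hsz : Nat.size i = Nat.size j := by omega
  have hi3 := two_pow_size_sub_one_le hi0
  have hj3 := two_pow_size_sub_one_le hj0
  rw [hsz] at hij hi3
  have := Nat.eq_of_mul_eq_mul_left (by positivity) hij
  omega

/-! ### Separation of sites and retention. -/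

/-- The site of an item within the first `2 ^ (s - 1 - r)` of its hanoi value lies in the block of
`2 ^ r` segments that its own segment starts, for every `r` from its meta-epoch on. -/
lemma site_mem_block {s y r : ℕ} (hr : metaEpoch (epoch s y) ≤ r) (hrs : r < s)
    (hi : y / 2 ^ (hanoi y + 1) < 2 ^ (s - 1 - r)) :
    ∃ q < 2 ^ (s - 1 - r), fillOrder s (y / 2 ^ (hanoi y + 1)) = 2 ^ r * q ∧
      segStart s (fillOrder s (y / 2 ^ (hanoi y + 1))) + hanoi y
        < segStart s (2 ^ r * (q + 1)) := by
  have hy := hanoi_decomp y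
  have hyt := lt_two_pow_epoch s y
  have ht := add_lt_two_pow_of_metaEpoch_le hr
  generalize y / 2 ^ (hanoi y + 1) = i at *
  generalize hanoi y = h at *
  generalize epoch s y = t at *
  by_cases hi0 : i = 0
  · subst hi0
    refine ⟨0, by positivity, by simp [fillOrder], ?_⟩
    have hh : h ≤ t + s := (Nat.pow_le_pow_iff_right (by norm_num : 1 < 2)).1 (by omega)
    have := segStart_two_pow s r
    simp only [fillOrder, if_true, zero_add, mul_one]
    rw [segStart, Finset.sum_range_zero]
    omega
  have hv := Nat.size_pos.2 (Nat.pos_of_ne_zero hi0)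
  have hvr := Nat.size_le.2 hi
  have his : i < 2 ^ (s - 1) := hi.trans_le (Nat.pow_le_pow_right (by norm_num) (by omega))
  have hlow := two_pow_size_sub_one_le hi0
  have hup := Nat.lt_size_self i
  rw [fillOrder_eq hi0 his]
  generalize Nat.size i = v at *
  set j := i - 2 ^ (v - 1) with hj
  have hq : 2 ^ (s - 1 - v) * (2 * j + 1) = 2 ^ r * (2 ^ (s - 1 - r - v) * (2 * j + 1)) := by
    rw [← mul_assoc, ← pow_add]
    congr 2
    omega
  have hpv : 2 ^ v = 2 * 2 ^ (v - 1) := by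
    rw [← pow_succ', Nat.sub_add_cancel hv]
  refine ⟨2 ^ (s - 1 - r - v) * (2 * j + 1), ?_, hq, ?_⟩
  · calc 2 ^ (s - 1 - r - v) * (2 * j + 1) < 2 ^ (s - 1 - r - v) * 2 ^ v :=
          Nat.mul_lt_mul_of_pos_left (by omega) (by positivity)
      _ = 2 ^ (s - 1 - r) := by rw [← pow_add]; congr 1; omega
  · rw [hq]
    have hblock := segStart_two_pow_mul_succ s r (q := 2 ^ (s - 1 - r - v) * (2 * j + 1))
      (Nat.mul_pos (by positivity) (by omega))
    rw [padicValNat_two_pow_mul_odd] at hblock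
    -- A late segment is reached only late in the stream: larger `v` shrinks the block, but also
    -- lowers the hanoi values seen by epoch `t`, by the same amount.
    have hh : v + h < t + s := by
      refine (Nat.pow_lt_pow_iff_right (by norm_num : 1 < 2)).1 ?_
      have h1 : 2 ^ (v + h) = 2 ^ (v - 1) * 2 ^ (h + 1) := by
        rw [← pow_add]; congr 1; omega
      have h2 : 2 ^ (v - 1) * 2 ^ (h + 1) ≤ i * 2 ^ (h + 1) := Nat.mul_le_mul_right _ hlow
      have h3 : 0 < 2 ^ h := by positivity
      omega
    omega

/-- The sites of two items, each within the first `2 ^ (s - 1 - r)` of its hanoi value, differ. -/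
lemma eq_of_site_eq {s y z r : ℕ} (hy : metaEpoch (epoch s y) ≤ r)
    (hz : metaEpoch (epoch s z) ≤ r) (hrs : r < s)
    (hiy : y / 2 ^ (hanoi y + 1) < 2 ^ (s - 1 - r))
    (hiz : z / 2 ^ (hanoi z + 1) < 2 ^ (s - 1 - r))
    (heq : segStart s (fillOrder s (y / 2 ^ (hanoi y + 1))) + hanoi y =
      segStart s (fillOrder s (z / 2 ^ (hanoi z + 1))) + hanoi z) : y = z := by
  obtain ⟨p, -, hp, hp'⟩ := site_mem_block hy hrs hiy
  obtain ⟨q, -, hq, hq'⟩ := site_mem_block hz hrs hiz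
  have key : ∀ {a b c d : ℕ}, segStart s (2 ^ r * a) + c = segStart s (2 ^ r * b) + d →
      segStart s (2 ^ r * b) + d < segStart s (2 ^ r * (b + 1)) → a ≤ b := by
    intro a b c d h1 h2
    by_contra! hab
    have := (segStart_strictMono s).monotone (Nat.mul_le_mul_left (2 ^ r) hab)
    rw [Nat.succ_eq_add_one] at this
    omega
  have hpq : p = q := by
    rw [hp] at hp' heq
    rw [hq] at hq' heq
    exact le_antisymm (key heq hq') (key heq.symm hp')
  have hfo := hp.trans ((congrArg (2 ^ r * ·) hpq).trans hq.symm)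
  have hh : hanoi y = hanoi z := by rw [hfo] at heq; omega
  have hle : 2 ^ (s - 1 - r) ≤ 2 ^ (s - 1) := Nat.pow_le_pow_right (by norm_num) (by omega)
  have hii := fillOrder_injOn s (hiy.trans_le hle) (hiz.trans_le hle) hfo
  have h1 := hanoi_decomp y
  have h2 := hanoi_decomp z
  rw [hii, hh] at h1
  omega

/-- Number of segments available to each hanoi value during a meta-epoch. -/
lemma max_one_div_eq {s r : ℕ} (hrs : r < s) : max 1 (2 ^ s / 2 ^ (r + 1)) = 2 ^ (s - 1 - r) := by
  rw [Nat.pow_div hrs (by norm_num), show s - (r + 1) = s - 1 - r by omega]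
  exact max_eq_right Nat.one_le_two_pow

lemma siteSelect_eq_some_iff {s y k : ℕ} (h : metaEpoch (epoch s y) < s) :
    siteSelect s y = some k ↔ y / 2 ^ (hanoi y + 1) < 2 ^ (s - 1 - metaEpoch (epoch s y)) ∧
      segStart s (fillOrder s (y / 2 ^ (hanoi y + 1))) + hanoi y = k := by
  simp only [siteSelect, max_one_div_eq h]
  split_ifs with hB
  · simp [not_lt.2 hB]
  · simp [not_le.1 hB]

/-- Segments available only shrink with time, so a rank allowed at `T` was allowed throughout. -/
lemma mem_retained {s T y : ℕ} (hs : 2 ≤ s) (hT : T < 2 ^ (2 ^ s - 1)) (hyT : y < T)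
    (hi : y / 2 ^ (hanoi y + 1) < 2 ^ (s - 1 - metaEpoch (epoch s T))) : y ∈ retained s T := by
  have mono : ∀ {a b}, a ≤ b → metaEpoch (epoch s a) ≤ metaEpoch (epoch s b) :=
    fun hab => metaEpoch_mono (epoch_mono s hab)
  have rank : ∀ {a b}, a ≤ b →
      2 ^ (s - 1 - metaEpoch (epoch s b)) ≤ 2 ^ (s - 1 - metaEpoch (epoch s a)) :=
    fun hab => Nat.pow_le_pow_right (by norm_num) (by have := mono hab; omega)
  have hlt : ∀ {a}, a ≤ T → metaEpoch (epoch s a) < s :=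
    fun ha => (mono ha).trans_lt (metaEpoch_lt hs hT)
  refine ⟨segStart s (fillOrder s (y / 2 ^ (hanoi y + 1))) + hanoi y, ?_, ⟨hyT, ?_⟩, ?_⟩
  · obtain ⟨q, hq, -, hsite⟩ := site_mem_block (mono hyT.le) (hlt le_rfl) hi
    refine hsite.trans_le ?_
    rw [← segStart_half (by omega : 1 ≤ s)]
    refine (segStart_strictMono s).monotone ?_
    have hr := hlt le_rfl
    calc 2 ^ metaEpoch (epoch s T) * (q + 1)
        ≤ 2 ^ metaEpoch (epoch s T) * 2 ^ (s - 1 - metaEpoch (epoch s T)) :=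
          Nat.mul_le_mul_left _ hq
      _ = 2 ^ (s - 1) := by rw [← pow_add]; congr 1; omega
  · exact (siteSelect_eq_some_iff (hlt hyT.le)).2 ⟨hi.trans_le (rank hyT.le), rfl⟩
  · rintro z ⟨hzT, hz⟩
    by_contra! hyz
    obtain ⟨hiz, heq⟩ := (siteSelect_eq_some_iff (hlt hzT.le)).1 hz
    -- Blocks are taken at the meta-epoch of the later item `z`, where both ranks are admissible.
    exact hyz.ne (eq_of_site_eq (mono hyz.le) le_rfl (hlt hzT.le) (hi.trans_le (rank hzT.le))
      hiz heq.symm)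

/-- All items of hanoi value at least `h` in an initial stretch of the stream are retained. -/
lemma mem_retained_of_dvd {s T y h : ℕ} (hs : 2 ≤ s) (hT : T < 2 ^ (2 ^ s - 1)) (hyT : y < T)
    (hd : 2 ^ h ∣ y + 1) (hy : y < 2 ^ (h + 1) * 2 ^ (s - 1 - metaEpoch (epoch s T))) :
    y ∈ retained s T := by
  refine mem_retained hs hT hyT (Nat.div_lt_of_lt_mul (hy.trans_le ?_))
  have := le_hanoi_of_dvd hd
  exact Nat.mul_le_mul_right _ (Nat.pow_le_pow_right (by norm_num) (by omega))

/-! ### Gap sizes and cost. -/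

lemma gapSize_mul_le {s T x : ℕ} (hs : 2 ≤ s) (hT : T < 2 ^ (2 ^ s - 1)) (hxT : x < T) :
    gapSize s T x * 2 ^ (s - 1 - metaEpoch (epoch s T)) ≤ x := by
  by_cases hx : x ∈ retained s T
  · simp [gapSize, hx]
  have hret := fun {y h : ℕ} => mem_retained_of_dvd (y := y) (h := h) hs hT
  generalize 2 ^ (s - 1 - metaEpoch (epoch s T)) = B at *
  have hBx : 2 * B ≤ x := by
    by_contra! hlt
    exact hx (hret (h := 0) hxT (by simp) (by simpa using hlt))
  rcases Nat.eq_zero_or_pos B with hB | hB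
  · simp [hB]
  set h := Nat.log 2 (x / B)
  have hne : x / B ≠ 0 := (Nat.div_pos (by omega) hB).ne'
  have hlo : 2 ^ h * B ≤ x :=
    (Nat.le_div_iff_mul_le hB).1 (Nat.pow_log_le_self 2 hne)
  have hhi : x < 2 ^ (h + 1) * B :=
    (Nat.div_lt_iff_lt_mul hB).1 (Nat.lt_pow_succ_log_self (by norm_num) _)
  have hP : 0 < 2 ^ h := by positivity
  suffices hgap : gapSize s T x ≤ 2 ^ h from (Nat.mul_le_mul_right _ hgap).trans hlo
  rw [gapSize, if_neg hx]
  refine csSup_le' ?_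
  rintro n ⟨i, j, rfl, hix, hsub⟩
  have hdis : ∀ y, x - i ≤ y → y < x + j → y < T ∧ y ∉ retained s T := fun y h1 h2 => hsub ⟨h1, h2⟩
  have hdm := Nat.div_add_mod x (2 ^ h)
  have hmod := Nat.mod_lt x hP
  have hm : 1 ≤ x / 2 ^ h :=
    Nat.div_pos ((Nat.le_mul_of_pos_right _ hB).trans hlo) hP
  have hPm : 2 ^ h ≤ 2 ^ h * (x / 2 ^ h) := Nat.le_mul_of_pos_right _ hm
  -- A run through `x` cannot cross the neighbouring times `y` with `2 ^ h ∣ y + 1`; on the right,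
  -- it may also stop at `T` first.
  have hleft : 2 ^ h * (x / 2 ^ h) - 1 < x - i := by
    by_contra! hle
    obtain ⟨h1, h2⟩ := hdis _ hle (by omega)
    exact h2 (hret (h := h) h1 ⟨x / 2 ^ h, by omega⟩ (by omega))
  have hright : x + j ≤ 2 ^ h * (x / 2 ^ h) + 2 ^ h - 1 := by
    by_contra! hlt
    obtain ⟨h1, h2⟩ := hdis (2 ^ h * (x / 2 ^ h) + 2 ^ h - 1) (by omega) hlt
    refine h2 (hret (h := h) h1 ⟨x / 2 ^ h + 1, by rw [mul_add]; omega⟩ ?_)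
    have h3 : x / 2 ^ h < 2 * B := by
      rw [Nat.div_lt_iff_lt_mul hP]
      calc x < 2 ^ (h + 1) * B := hhi
        _ = 2 * B * 2 ^ h := by ring
    have h4 : 2 ^ h * (x / 2 ^ h + 1) ≤ 2 ^ h * (2 * B) := Nat.mul_le_mul_left _ h3
    rw [show 2 ^ (h + 1) * B = 2 ^ h * (2 * B) by ring]
    rw [mul_add] at h4
    omega
  omega

lemma gapSize_eq_zero {s T x : ℕ} (hs : 2 ≤ s) (ht : epoch s T = 0) (hxT : x < T)
    (hT : T < 2 ^ (2 ^ s - 1)) : gapSize s T x = 0 := by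
  have hTs := lt_two_pow_epoch s T
  rw [ht, zero_add] at hTs
  have hx : x ∈ retained s T := by
    refine mem_retained_of_dvd (h := 0) hs hT hxT (by simp) ?_
    rw [ht, show metaEpoch 0 = 0 from rfl, ← pow_add, show 0 + 1 + (s - 1 - 0) = s by omega]
    omega
  simp [gapSize, hx]

lemma costStretched_le {s T : ℕ} {c : ℝ} (hc : 0 ≤ c)
    (h : ∀ x, 1 ≤ x → x < T → (gapSize s T x : ℝ) ≤ c * x) : costStretched s T ≤ c := by
  -- `hc` covers the empty set, whose supremum is `0`.
  refine Real.sSup_le ?_ hc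
  rintro _ ⟨x, ⟨hx1, hxT⟩, rfl⟩
  exact (div_le_iff₀ (by exact_mod_cast hx1)).2 (h x hx1 hxT)

lemma costStretched_le_two_pow {s T : ℕ} (hs : 2 ≤ s) (hT : T < 2 ^ (2 ^ s - 1)) :
    costStretched s T ≤ (2 : ℝ) ^ (metaEpoch (epoch s T) + 1) / 2 ^ s := by
  refine costStretched_le (by positivity) fun x _ hxT => ?_
  have hgap : (gapSize s T x : ℝ) * 2 ^ (s - 1 - metaEpoch (epoch s T)) ≤ x := by
    exact_mod_cast gapSize_mul_le hs hT hxT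
  have hr := metaEpoch_lt hs hT
  have hpow : (2 : ℝ) ^ s = 2 ^ (metaEpoch (epoch s T) + 1) *
      2 ^ (s - 1 - metaEpoch (epoch s T)) := by
    rw [← pow_add]; congr 1; omega
  rw [hpow, div_mul_eq_div_div, div_self (by positivity), one_div_mul_eq_div]
  exact (le_div_iff₀ (by positivity)).2 hgap

end DStream

theorem mainTheorem2 (s T : ℕ) (hs : 2 ≤ s) (hT : T < 2 ^ (2 ^ s - 1)) :
    DStream.costStretched s T ≤
      min ((2 : ℝ) ^ (DStream.metaEpoch (DStream.epoch s T) + 1) / 2 ^ s)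
        (min (2 * ((DStream.epoch s T : ℝ) + s) / 2 ^ s)
          (4 * (DStream.epoch s T : ℝ) / 2 ^ s)) := by
  have hmain := DStream.costStretched_le_two_pow hs hT
  rcases Nat.eq_zero_or_pos (DStream.epoch s T) with ht | ht
  · have h0 : DStream.costStretched s T ≤ 0 :=
      DStream.costStretched_le le_rfl fun x _ hxT => by
        simp [DStream.gapSize_eq_zero hs ht hxT hT]
    exact le_min hmain (le_min (h0.trans (by positivity)) (h0.trans (by positivity)))
  · have h1 := DStream.two_pow_metaEpoch_le ht
    have h2 := DStream.metaEpoch_le (DStream.epoch s T)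
    have h3 := DStream.metaEpoch_lt hs hT
    generalize DStream.epoch s T = t at *
    have hs' : (2 : ℝ) ^ DStream.metaEpoch t ≤ t + s := by
      exact_mod_cast h1.trans (by omega)
    have ht' : (2 : ℝ) ^ DStream.metaEpoch t ≤ 2 * t := by
      exact_mod_cast h1.trans (by omega)
    refine le_min hmain (le_min (hmain.trans ?_) (hmain.trans ?_))
    · gcongr
      rw [pow_succ]; linarith
    · gcongr
      rw [pow_succ]; linarith
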